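/- Let $\phi=\{\phi_n\}_{n\ge1}$ be any sequence of bipartite pure states, given by unit vectors $|\phi_n\rangle\in\mathcal H_A^{(n)}\otimes\mathcal H_B^{(n)}$ with all spaces finite-dimensional, and let $\rho=\{\rho_n\}_{n\ge1}$ be the sequence of reduced states on either subsystem, $\rho_n=\mathrm{Tr}_A|\phi_n\rangle\langle\phi_n|$ or $\rho_n=\mathrm{Tr}_B|\phi_n\rangle\langle\phi_n|$. A dilution protocol consists, for each $n$, of an integer $M_n\ge1$ and a (finite-round, two-way) LOCC operation $\mathcal T_n$ from $\mathbb C^{M_n}\otimes\mathbb C^{M_n}$ to $\mathcal H_A^{(n)}\otimes\mathcal H_B^{(n)}$. Its fidelity is $F_n=\langle\phi_n|\,\mathcal T_n(|\Psi^+_{M_n}\rangle\langle\Psi^+_{M_n}|)\,|\phi_n\rangle$, where $|\Psi^+_{M}\rangle=M^{-1/2}\sum_{i=1}^{M}|i\rangle\otimes|i\rangle$. It has rate $R\in\mathbb R$ if $\frac1n\log M_n\le R$ for all sufficiently large $n$ (natural logarithm). The strong converse rate of entanglement dilution is $$E_C^*=\sup\Big\{R\in\mathbb R:\ \lim_{n\to\infty}F_n=0\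 \text{ for every dilution protocol of rate } R\Big\}\in[-\infty,\infty].$$ For a self-adjoint operator $A$ let $\{A\ge0\}$ denote the projection onto the span of the eigenvectors of $A$ with nonnegative eigenvalues. The inf-spectral entropy rate is $\underline S(\rho)=-\overline D(\rho\|I)$, where $$\overline D(\rho\|I)=\inf\Big\{\gamma\in\mathbb R:\ \limsup_{n\to\infty}\mathrm{Tr}\big[\{\Pi_n(\gamma)\ge0\}\,\Pi_n(\gamma)\big]=0\Big\},\qquad \Pi_n(\gamma)=\rho_n-e^{n\gamma}I_n .$$ Then $E_C^*=\underline S(\rho)$ (as extended real numbers; both are $+\infty$ or both are the same finite number), for either choice of subsystem. -/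

import Mathlib

open Filter Topology Matrix
open scoped Kronecker

namespace EntanglementDilution

noncomputable section

/-- Operators on the bipartite Hilbert space `ℂ^a ⊗ ℂ^b`. -/
abbrev BipartiteOp (a b : ℕ) : Type := Matrix (Fin a × Fin b) (Fin a × Fin b) ℂ

/-- Vectors of the bipartite Hilbert space `ℂ^a ⊗ ℂ^b`, in the product basis. -/
abbrev BipartiteVec (a b : ℕ) : Type := Fin a × Fin b → ℂ

/-- The rank-one operator `|v⟩⟨v|`. -/
def ketBra {a b : ℕ} (v : BipartiteVec a b) : BipartiteOp a b := vecMulVec v (star v)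

/-- The partial trace over the second subsystem. -/
def partialTraceB {a b : ℕ} (X : BipartiteOp a b) : Matrix (Fin a) (Fin a) ℂ :=
  fun i i' => ∑ j, X (i, j) (i', j)

/-- The partial trace over the first subsystem. -/
def partialTraceA {a b : ℕ} (X : BipartiteOp a b) : Matrix (Fin b) (Fin b) ℂ :=
  fun j j' => ∑ i, X (i, j) (i, j')

/-! ### Spectral projections and spectral entropy rates -/

/-- The spectral projection `{A ≥ 0}` of a self-adjoint matrix `A`: the sum of the spectral
projections of `A` for its nonnegative eigenvalues, i.e. the indicator function of `[0, ∞)`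
applied to `A` (the spectrum is finite, so every function is admissible here). -/
def specProjNonneg {d : ℕ} (A : Matrix (Fin d) (Fin d) ℂ) : Matrix (Fin d) (Fin d) ℂ :=
  cfc (fun x : ℝ => if 0 ≤ x then (1 : ℝ) else 0) A

/-- The difference operator `Π_n(γ) = ρ_n - e^{nγ} ω_n`. -/
def diffOp {d : ℕ → ℕ} (ρ ω : ∀ n, Matrix (Fin (d n)) (Fin (d n)) ℂ) (γ : ℝ) (n : ℕ) :
    Matrix (Fin (d n)) (Fin (d n)) ℂ :=
  ρ n - ((Real.exp (n * γ) : ℝ) : ℂ) • ω n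

/-- The spectral sup-divergence rate
`inf {γ : limsup_n Tr[{Π_n(γ) ≥ 0} Π_n(γ)] = 0}`, with values in the extended reals. -/
def supDivergenceRate {d : ℕ → ℕ} (ρ ω : ∀ n, Matrix (Fin (d n)) (Fin (d n)) ℂ) : EReal :=
  sInf (Real.toEReal '' {γ : ℝ |
    limsup (fun n => (specProjNonneg (diffOp ρ ω γ n) * diffOp ρ ω γ n).trace.re) atTop = 0})

/-- The inf-spectral entropy rate: minus the sup-divergence rate relative to the sequence of
identity operators. -/
def infSpectralEntropyRate {d : ℕ → ℕ} (ρ : ∀ n, Matrix (Fin (d n)) (Fin (d n)) ℂ) : EReal :=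
  -supDivergenceRate ρ (fun _ => 1)

/-! ### LOCC operations -/

/-- Finite-round (two-way) LOCC operations with output space `ℂ^a' ⊗ ℂ^b'`.
Either nothing is left to be done, or one of the parties applies a local quantum measurement,
given by Kraus operators `K i` with `∑ i, (K i)ᴴ * K i = 1` (possibly changing the dimension of
the local space), announces the outcome `i`, and the parties go on with an LOCC operation `T i`
that may depend on `i`. A local channel is the case in which `T i` does not depend on `i`. -/
inductive IsLOCC {a' b' : ℕ} : {a b : ℕ} → (BipartiteOp a b → BipartiteOp a' b') → Prop
  | done : IsLOCC (fun X : BipartiteOp a' b' => X)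
  | alice {a b k : ℕ} (d : Fin k → ℕ) (K : (i : Fin k) → Matrix (Fin (d i)) (Fin a) ℂ)
      (hK : ∑ i, (K i)ᴴ * K i = 1)
      (T : (i : Fin k) → BipartiteOp (d i) b → BipartiteOp a' b')
      (hT : ∀ i, IsLOCC (T i)) :
      IsLOCC (fun X : BipartiteOp a b =>
        ∑ i, T i ((K i ⊗ₖ (1 : Matrix (Fin b) (Fin b) ℂ)) * X *
          (K i ⊗ₖ (1 : Matrix (Fin b) (Fin b) ℂ))ᴴ))
  | bob {a b k : ℕ} (d : Fin k → ℕ) (K : (i : Fin k) → Matrix (Fin (d i)) (Fin b) ℂ)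
      (hK : ∑ i, (K i)ᴴ * K i = 1)
      (T : (i : Fin k) → BipartiteOp a (d i) → BipartiteOp a' b')
      (hT : ∀ i, IsLOCC (T i)) :
      IsLOCC (fun X : BipartiteOp a b =>
        ∑ i, T i (((1 : Matrix (Fin a) (Fin a) ℂ) ⊗ₖ K i) * X *
          ((1 : Matrix (Fin a) (Fin a) ℂ) ⊗ₖ K i)ᴴ))

/-! ### Entanglement dilution -/

/-- The maximally entangled vector `M^{-1/2} ∑ i, |i⟩ ⊗ |i⟩` of rank `M`. -/
def maxEntangled (M : ℕ) : BipartiteVec M M :=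
  fun p => if p.1 = p.2 then (((Real.sqrt M)⁻¹ : ℝ) : ℂ) else 0

/-- A dilution protocol: for every `n`, a rank `M n ≥ 1` of the maximally entangled initial state
and an LOCC operation `T n` from `ℂ^(M n) ⊗ ℂ^(M n)` to `ℂ^(dA n) ⊗ ℂ^(dB n)`. -/
structure DilutionProtocol (dA dB : ℕ → ℕ) where
  M : ℕ → ℕ
  M_pos : ∀ n, 0 < M n
  T : ∀ n, BipartiteOp (M n) (M n) → BipartiteOp (dA n) (dB n)
  isLOCC : ∀ n, IsLOCC (T n)

/-- The protocol works at rate `R`: `(1/n) log M_n ≤ R` for all large `n`. -/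
def DilutionProtocol.HasRate {dA dB : ℕ → ℕ} (P : DilutionProtocol dA dB) (R : ℝ) : Prop :=
  ∀ᶠ n : ℕ in atTop, 1 / (n : ℝ) * Real.log (P.M n) ≤ R

/-- The fidelity `F_n = ⟨φ_n| T_n(|Ψ⁺⟩⟨Ψ⁺|) |φ_n⟩`, with `Ψ⁺` of rank `M_n`. -/
def DilutionProtocol.fidelity {dA dB : ℕ → ℕ} (P : DilutionProtocol dA dB)
    (φ : ∀ n, BipartiteVec (dA n) (dB n)) (n : ℕ) : ℝ :=
  (star (φ n) ⬝ᵥ (P.T n (ketBra (maxEntangled (P.M n))) *ᵥ φ n)).re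

/-- The strong converse rate of entanglement dilution: the supremum, in the extended reals, of all
real `R` such that every dilution protocol of rate `R` has fidelity tending to `0`. -/
def strongConverseDilutionRate {dA dB : ℕ → ℕ} (φ : ∀ n, BipartiteVec (dA n) (dB n)) : EReal :=
  sSup (Real.toEReal '' {R : ℝ | ∀ P : DilutionProtocol dA dB,
    P.HasRate R → Tendsto (P.fidelity φ) atTop (𝓝 0)})

end

end EntanglementDilution

/-! Everything rests on two one-shot bounds in terms of t(c) = Tr (ρ - cI)₊, where ρ is the reduced
state of `φ`.

Converse: LOCC cannot raise the Schmidt rank, so every branch starting from rank M has Schmidt rank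
at most M. By Cauchy–Schwarz, its squared overlap with `φ` is at most its weight times Tr Pρ for a
projection P of rank at most M, and Tr Pρ ≤ t(c) + cM. Hence F ≤ t(c) + cM for all c ≥ 0
(`IsLOCC.overlap_maxEntangled_le`).

Achievability: at most 1/c eigenvalues of ρ are at least c, and their sum is at least t(c).
Projecting `φ` onto the corresponding eigenvectors leaves a state that LOCC prepares exactly from a
maximally entangled one (`exists_isLOCC_posPartTrace_le`).

With c = exp(nγ), the converse makes F vanish at every rate R < -γ once t → 0. With c = exp(-nR),
achievability forces t → 0 whenever R is a strong converse rate. The other subsystem follows by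
exchanging the parties. -/

namespace EntanglementDilution

noncomputable section

/-! ### Bipartite vectors as matrices -/

/-- The coefficient matrix of a bipartite vector. -/
def coeffMatrix {a b : ℕ} (v : BipartiteVec a b) : Matrix (Fin a) (Fin b) ℂ :=
  fun i j => v (i, j)

/-- The expectation value `⟨φ| X |φ⟩`. -/
def overlap {a b : ℕ} (φ : BipartiteVec a b) (X : BipartiteOp a b) : ℝ :=
  (star φ ⬝ᵥ (X *ᵥ φ)).re

lemma partialTraceB_ketBra {a b : ℕ} (v : BipartiteVec a b) :
    partialTraceB (ketBra v) = coeffMatrix v * (coeffMatrix v)ᴴ := rfl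

lemma overlap_sum {a b : ℕ} {ι : Type*} (s : Finset ι) (φ : BipartiteVec a b)
    (X : ι → BipartiteOp a b) : overlap φ (∑ i ∈ s, X i) = ∑ i ∈ s, overlap φ (X i) := by
  simp only [overlap, Matrix.sum_mulVec, dotProduct_sum, Complex.re_sum]

lemma overlap_ketBra {a b : ℕ} (φ w : BipartiteVec a b) :
    overlap φ (ketBra w) = ‖star φ ⬝ᵥ w‖ ^ 2 := by
  have h : star w ⬝ᵥ φ = star (star φ ⬝ᵥ w) := by
    rw [star_dotProduct]
  rw [overlap, ketBra, vecMulVec_mulVec, ← Complex.normSq_eq_norm_sq, h]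
  simp [Complex.normSq_apply, dotProduct_smul]

lemma mul_ketBra_mul {a b c d : ℕ} (K : Matrix (Fin c × Fin d) (Fin a × Fin b) ℂ)
    (v : BipartiteVec a b) : K * ketBra v * Kᴴ = ketBra (K *ᵥ v) := by
  rw [ketBra, ketBra, mul_vecMulVec, vecMulVec_mul, star_mulVec]

/-- Local operators become one-sided matrix products, so the Schmidt rank, which is the rank of the
coefficient matrix, cannot grow. -/
lemma coeffMatrix_kronecker_one_mulVec {a b c : ℕ} (K : Matrix (Fin c) (Fin a) ℂ)
    (v : BipartiteVec a b) :
    coeffMatrix ((K ⊗ₖ (1 : Matrix (Fin b) (Fin b) ℂ)) *ᵥ v) = K * coeffMatrix v := by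
  ext i j
  simp [coeffMatrix, mulVec, dotProduct, Matrix.mul_apply, Fintype.sum_prod_type, one_apply]

lemma coeffMatrix_one_kronecker_mulVec {a b c : ℕ} (K : Matrix (Fin c) (Fin b) ℂ)
    (v : BipartiteVec a b) :
    coeffMatrix (((1 : Matrix (Fin a) (Fin a) ℂ) ⊗ₖ K) *ᵥ v) = coeffMatrix v * Kᵀ := by
  ext i j
  simp [coeffMatrix, mulVec, dotProduct, Matrix.mul_apply, Fintype.sum_prod_type, one_apply,
    mul_comm]

lemma dotProduct_eq_trace {a b : ℕ} (v w : BipartiteVec a b) :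
    star v ⬝ᵥ w = ((coeffMatrix v)ᴴ * coeffMatrix w).trace := by
  simp only [dotProduct, Matrix.trace, Matrix.diag, Matrix.mul_apply, coeffMatrix,
    conjTranspose_apply, Fintype.sum_prod_type, Pi.star_apply]
  exact Finset.sum_comm

/-! ### LOCC on pure states -/

lemma norm_sq_mulVec_kraus {m n : Type*} [Fintype m] [Fintype n] (K : Matrix m n ℂ) (v : n → ℂ) :
    star (K *ᵥ v) ⬝ᵥ (K *ᵥ v) = star v ⬝ᵥ ((Kᴴ * K) *ᵥ v) := by
  rw [star_mulVec, ← dotProduct_mulVec, mulVec_mulVec]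

lemma sum_norm_sq_alice {a b k : ℕ} {d : Fin k → ℕ} (K : (i : Fin k) → Matrix (Fin (d i)) (Fin a) ℂ)
    (hK : ∑ i, (K i)ᴴ * K i = 1) (v : BipartiteVec a b) :
    ∑ i, star ((K i ⊗ₖ (1 : Matrix (Fin b) (Fin b) ℂ)) *ᵥ v) ⬝ᵥ
      ((K i ⊗ₖ (1 : Matrix (Fin b) (Fin b) ℂ)) *ᵥ v) = star v ⬝ᵥ v := by
  simp only [norm_sq_mulVec_kraus, dotProduct_eq_trace, Matrix.conjTranspose_kronecker,
    ← Matrix.mul_kronecker_mul, conjTranspose_one, one_mul, coeffMatrix_kronecker_one_mulVec]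
  rw [← Matrix.trace_sum, ← Matrix.mul_sum, ← Matrix.sum_mul, hK, Matrix.one_mul]

lemma sum_norm_sq_bob {a b k : ℕ} {d : Fin k → ℕ} (K : (i : Fin k) → Matrix (Fin (d i)) (Fin b) ℂ)
    (hK : ∑ i, (K i)ᴴ * K i = 1) (v : BipartiteVec a b) :
    ∑ i, star (((1 : Matrix (Fin a) (Fin a) ℂ) ⊗ₖ K i) *ᵥ v) ⬝ᵥ
      (((1 : Matrix (Fin a) (Fin a) ℂ) ⊗ₖ K i) *ᵥ v) = star v ⬝ᵥ v := by
  simp only [norm_sq_mulVec_kraus, dotProduct_eq_trace, Matrix.conjTranspose_kronecker,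
    ← Matrix.mul_kronecker_mul, conjTranspose_one, one_mul, coeffMatrix_one_kronecker_mulVec]
  rw [← Matrix.trace_sum, ← Matrix.mul_sum, ← Matrix.mul_sum, ← Matrix.transpose_sum, hK,
    transpose_one, Matrix.mul_one]

/-- LOCC operations do not increase the Schmidt rank, hence a bound on the overlap with all
vectors of Schmidt rank at most `M` bounds the overlap with the outputs of LOCC operations. -/
theorem IsLOCC.overlap_le {a b a' b' : ℕ} {T : BipartiteOp a b → BipartiteOp a' b'}
    (hT : IsLOCC T) (φ : BipartiteVec a' b') (M : ℕ) (q : ℝ)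
    (hq : ∀ w : BipartiteVec a' b', (coeffMatrix w).rank ≤ M →
      ‖star φ ⬝ᵥ w‖ ^ 2 ≤ q * (star w ⬝ᵥ w).re)
    (v : BipartiteVec a b) (hv : (coeffMatrix v).rank ≤ M) :
    overlap φ (T (ketBra v)) ≤ q * (star v ⬝ᵥ v).re := by
  -- Branches stay pure but unnormalized. The bound is homogeneous in the squared norm, and the
  -- squared norms of the branches add up to that of `v`.
  induction hT with
  | done => rw [overlap_ketBra]; exact hq v hv
  | alice d K hK T _ ih =>
    rw [overlap_sum, ← sum_norm_sq_alice K hK v, Complex.re_sum, Finset.mul_sum]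
    refine Finset.sum_le_sum fun i _ => ?_
    rw [mul_ketBra_mul]
    refine ih i _ ?_
    rw [coeffMatrix_kronecker_one_mulVec]
    exact (rank_mul_le_right _ _).trans hv
  | bob d K hK T _ ih =>
    rw [overlap_sum, ← sum_norm_sq_bob K hK v, Complex.re_sum, Finset.mul_sum]
    refine Finset.sum_le_sum fun i _ => ?_
    rw [mul_ketBra_mul]
    refine ih i _ ?_
    rw [coeffMatrix_one_kronecker_mulVec]
    exact (rank_mul_le_left _ _).trans hv

theorem IsLOCC.overlap_nonneg {a b a' b' : ℕ} {T : BipartiteOp a b → BipartiteOp a' b'}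
    (hT : IsLOCC T) (φ : BipartiteVec a' b') (v : BipartiteVec a b) :
    0 ≤ overlap φ (T (ketBra v)) := by
  induction hT with
  | done => rw [overlap_ketBra]; positivity
  | alice d K hK T _ ih =>
    rw [overlap_sum]
    exact Finset.sum_nonneg fun i _ => by rw [mul_ketBra_mul]; exact ih i _
  | bob d K hK T _ ih =>
    rw [overlap_sum]
    exact Finset.sum_nonneg fun i _ => by rw [mul_ketBra_mul]; exact ih i _

/-! ### Exchanging the parties in a protocol -/

/-- Exchange of the two subsystems. -/
def swapOp {a b : ℕ} (X : BipartiteOp a b) : BipartiteOp b a := X.submatrix Prod.swap Prod.swap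

lemma swapOp_sandwich_alice {a b d : ℕ} (K : Matrix (Fin d) (Fin a) ℂ) (X : BipartiteOp b a) :
    (K ⊗ₖ (1 : Matrix (Fin b) (Fin b) ℂ)) * swapOp X * (K ⊗ₖ (1 : Matrix (Fin b) (Fin b) ℂ))ᴴ =
    swapOp (((1 : Matrix (Fin b) (Fin b) ℂ) ⊗ₖ K) * X *
      ((1 : Matrix (Fin b) (Fin b) ℂ) ⊗ₖ K)ᴴ) := by
  have h : (K ⊗ₖ (1 : Matrix (Fin b) (Fin b) ℂ)) =
      ((1 : Matrix (Fin b) (Fin b) ℂ) ⊗ₖ K).submatrix Prod.swap (Equiv.prodComm _ _) := by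
    ext ⟨i, j⟩ ⟨i', j'⟩; simp [mul_comm]
  have h' : swapOp X = X.submatrix (Equiv.prodComm _ _) (Equiv.prodComm _ _) := rfl
  rw [h, h', conjTranspose_submatrix, submatrix_mul_equiv, submatrix_mul_equiv]
  rfl

lemma swapOp_sandwich_bob {a b d : ℕ} (K : Matrix (Fin d) (Fin b) ℂ) (X : BipartiteOp b a) :
    ((1 : Matrix (Fin a) (Fin a) ℂ) ⊗ₖ K) * swapOp X * ((1 : Matrix (Fin a) (Fin a) ℂ) ⊗ₖ K)ᴴ =
    swapOp ((K ⊗ₖ (1 : Matrix (Fin a) (Fin a) ℂ)) * X *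
      (K ⊗ₖ (1 : Matrix (Fin a) (Fin a) ℂ))ᴴ) := by
  have h := congrArg swapOp (swapOp_sandwich_alice K (swapOp X))
  exact h.symm

lemma swapOp_sum {a b : ℕ} {ι : Type*} (s : Finset ι) (X : ι → BipartiteOp a b) :
    swapOp (∑ i ∈ s, X i) = ∑ i ∈ s, swapOp (X i) := by
  ext p q
  simp [swapOp, Matrix.sum_apply]

theorem IsLOCC.swap {a b a' b' : ℕ} {T : BipartiteOp a b → BipartiteOp a' b'} (hT : IsLOCC T) :
    IsLOCC (fun X : BipartiteOp b a => swapOp (T (swapOp X))) := by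
  induction hT with
  | done => exact IsLOCC.done
  | alice d K hK T _ ih =>
    simp only [swapOp_sandwich_alice, swapOp_sum]
    exact IsLOCC.bob d K hK _ ih
  | bob d K hK T _ ih =>
    simp only [swapOp_sandwich_bob, swapOp_sum]
    exact IsLOCC.alice d K hK _ ih

/-! ### The positive part of ρ - cI -/

/-- The trace of the positive part of `ρ - c I`. -/
def posPartTrace {d : ℕ} (ρ : Matrix (Fin d) (Fin d) ℂ) (c : ℝ) : ℝ :=
  (specProjNonneg (ρ - (c : ℂ) • 1) * (ρ - (c : ℂ) • 1)).trace.re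

theorem exists_diagonalization_posPartTrace {d : ℕ} {ρ : Matrix (Fin d) (Fin d) ℂ}
    (hρ : ρ.IsHermitian) (c : ℝ) :
    ∃ (U : Matrix (Fin d) (Fin d) ℂ) (l : Fin d → ℝ), Uᴴ * U = 1 ∧ U * Uᴴ = 1 ∧
      Uᴴ * ρ * U = diagonal (fun i => (l i : ℂ)) ∧ posPartTrace ρ c = ∑ i, max (l i - c) 0 := by
  set A := ρ - (c : ℂ) • 1 with hA_def
  have hA : A.IsHermitian := by
    refine hρ.sub ?_
    rw [Matrix.IsHermitian, conjTranspose_smul]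
    simp
  have hU : (hA.eigenvectorUnitary : Matrix (Fin d) (Fin d) ℂ)ᴴ * hA.eigenvectorUnitary = 1 :=
    Unitary.coe_star_mul_self hA.eigenvectorUnitary
  have hU' : (hA.eigenvectorUnitary : Matrix (Fin d) (Fin d) ℂ) *
      (hA.eigenvectorUnitary : Matrix (Fin d) (Fin d) ℂ)ᴴ = 1 :=
    Unitary.coe_mul_star_self hA.eigenvectorUnitary
  have hspec : A = (hA.eigenvectorUnitary : Matrix (Fin d) (Fin d) ℂ) *
      diagonal (fun i => (hA.eigenvalues i : ℂ)) *
      (hA.eigenvectorUnitary : Matrix (Fin d) (Fin d) ℂ)ᴴ := hA.spectral_theorem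
  have hproj : specProjNonneg A = (hA.eigenvectorUnitary : Matrix (Fin d) (Fin d) ℂ) *
      diagonal (fun i => ((if 0 ≤ hA.eigenvalues i then (1 : ℝ) else 0 : ℝ) : ℂ)) *
      (hA.eigenvectorUnitary : Matrix (Fin d) (Fin d) ℂ)ᴴ := by
    rw [specProjNonneg, hA.cfc_eq]
    rfl
  generalize (hA.eigenvectorUnitary : Matrix (Fin d) (Fin d) ℂ) = U at *
  generalize hA.eigenvalues = m at *
  -- The diagonalization is that of ρ - cI, to which the spectral projection applies directly; the
  -- eigenvalues of ρ are recovered by adding c.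
  refine ⟨U, fun i => m i + c, hU, hU', ?_, ?_⟩
  · have : ρ = A + (c : ℂ) • 1 := by simp [hA_def]
    rw [this, hspec, Matrix.mul_add, Matrix.add_mul, Matrix.mul_smul, Matrix.smul_mul,
      Matrix.mul_one, hU]
    rw [show Uᴴ * (U * diagonal (fun i => (m i : ℂ)) * Uᴴ) * U =
      (Uᴴ * U) * diagonal (fun i => (m i : ℂ)) * (Uᴴ * U) by simp only [Matrix.mul_assoc], hU]
    ext i j
    by_cases h : i = j <;> simp [h]
  · have hmul : specProjNonneg A * A =
        U * diagonal (fun i => ((max (m i) 0 : ℝ) : ℂ)) * Uᴴ := by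
      rw [hproj]
      conv_lhs => rw [hspec]
      rw [show ∀ D E : Matrix (Fin d) (Fin d) ℂ, U * D * Uᴴ * (U * E * Uᴴ) =
        U * (D * (Uᴴ * U) * E) * Uᴴ from fun D E => by simp only [Matrix.mul_assoc], hU,
        Matrix.mul_one, diagonal_mul_diagonal]
      congr 3
      ext i
      split_ifs with h
      · simp [max_eq_left h]
      · simp [max_eq_right (not_le.1 h).le]
    rw [posPartTrace, ← hA_def, hmul, trace_mul_comm, ← Matrix.mul_assoc, hU, Matrix.one_mul,
      trace_diagonal, Complex.re_sum]
    simp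

theorem posPartTrace_nonneg {d : ℕ} {ρ : Matrix (Fin d) (Fin d) ℂ} (hρ : ρ.IsHermitian) (c : ℝ) :
    0 ≤ posPartTrace ρ c := by
  obtain ⟨U, l, -, -, -, h⟩ := exists_diagonalization_posPartTrace hρ c
  rw [h]
  exact Finset.sum_nonneg fun i _ => le_max_right _ _

open scoped ComplexOrder in
/-- Every matrix is fixed by an orthogonal projection of the same rank. -/
theorem exists_range_projection {m n : ℕ} (W : Matrix (Fin m) (Fin n) ℂ) :
    ∃ P : Matrix (Fin m) (Fin m) ℂ, Pᴴ = P ∧ P * P = P ∧ P * W = W ∧ P.trace = (W.rank : ℂ) := by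
  have hA : (W * Wᴴ).IsHermitian := isHermitian_mul_conjTranspose_self W
  have hU : (hA.eigenvectorUnitary : Matrix (Fin m) (Fin m) ℂ)ᴴ * hA.eigenvectorUnitary = 1 :=
    Unitary.coe_star_mul_self hA.eigenvectorUnitary
  have hspec : W * Wᴴ = (hA.eigenvectorUnitary : Matrix (Fin m) (Fin m) ℂ) *
      diagonal (fun i => (hA.eigenvalues i : ℂ)) *
      (hA.eigenvectorUnitary : Matrix (Fin m) (Fin m) ℂ)ᴴ := hA.spectral_theorem
  have hrank : W.rank = Fintype.card {i // hA.eigenvalues i ≠ 0} := by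
    rw [← hA.rank_eq_card_non_zero_eigs, rank_self_mul_conjTranspose]
  generalize (hA.eigenvectorUnitary : Matrix (Fin m) (Fin m) ℂ) = U at *
  generalize hA.eigenvalues = l at *
  set D : Matrix (Fin m) (Fin m) ℂ := diagonal (fun i => if l i ≠ 0 then 1 else 0) with hD
  have hmul : ∀ E F : Matrix (Fin m) (Fin m) ℂ, U * E * Uᴴ * (U * F * Uᴴ) = U * (E * F) * Uᴴ := by
    intro E F
    rw [show U * E * Uᴴ * (U * F * Uᴴ) = U * (E * (Uᴴ * U) * F) * Uᴴ by
      simp only [Matrix.mul_assoc], hU, Matrix.mul_one]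
  have hherm : (U * D * Uᴴ)ᴴ = U * D * Uᴴ := by
    simp only [conjTranspose_mul, conjTranspose_conjTranspose, hD, diagonal_conjTranspose,
      Matrix.mul_assoc]
    congr 3
    ext i
    simp [apply_ite]
  refine ⟨U * D * Uᴴ, hherm, ?_, ?_, ?_⟩
  · rw [hmul, hD, diagonal_mul_diagonal]
    congr 3
    ext i
    by_cases h : l i = 0 <;> simp [h]
  · have h1 : U * D * Uᴴ * (W * Wᴴ) = W * Wᴴ := by
      rw [hspec, hmul, hD, diagonal_mul_diagonal]
      congr 3
      ext i
      by_cases h : l i = 0 <;> simp [h]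
    have h2 : (U * D * Uᴴ * W - W) * (U * D * Uᴴ * W - W)ᴴ = 0 := by
      rw [conjTranspose_sub, conjTranspose_mul, Matrix.mul_sub, Matrix.sub_mul, Matrix.sub_mul,
        ← Matrix.mul_assoc, ← Matrix.mul_assoc, Matrix.mul_assoc _ W, h1]
      simp
    exact sub_eq_zero.1 (self_mul_conjTranspose_eq_zero.1 h2)
  · rw [trace_mul_comm, ← Matrix.mul_assoc, hU, Matrix.one_mul, hD, trace_diagonal, hrank,
      Fintype.card_subtype]
    simp only [Finset.sum_boole]

/-- The trace of `ρ` on a subspace of dimension `Tr P` exceeds `c Tr P` by at most the trace of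
the positive part of `ρ - c I`. -/
theorem trace_projection_mul_le {d : ℕ} {ρ P : Matrix (Fin d) (Fin d) ℂ} (hρ : ρ.IsHermitian)
    (hP : Pᴴ = P) (hPP : P * P = P) (c : ℝ) :
    (P * ρ).trace.re ≤ posPartTrace ρ c + c * P.trace.re := by
  obtain ⟨U, l, hU, hU', hd, ht⟩ := exists_diagonalization_posPartTrace hρ c
  set Q := Uᴴ * P * U with hQ
  have hQH : Qᴴ = Q := by
    simp only [hQ, conjTranspose_mul, conjTranspose_conjTranspose, hP, Matrix.mul_assoc]
  have hQQ : Q * Q = Q := by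
    rw [hQ, show Uᴴ * P * U * (Uᴴ * P * U) = Uᴴ * (P * (U * Uᴴ) * P) * U by
      simp only [Matrix.mul_assoc], hU', Matrix.mul_one, hPP]
  -- Since Q is a projection, this identity confines its diagonal entries to [0, 1].
  have hsum : ∀ i, (Q i i).re = ∑ j, ‖Q i j‖ ^ 2 := by
    intro i
    conv_lhs => rw [← hQQ, Matrix.mul_apply, Complex.re_sum]
    refine Finset.sum_congr rfl fun j _ => ?_
    have : Q j i = star (Q i j) := by
      conv_lhs => rw [← hQH]
      rfl
    rw [this, ← Complex.normSq_eq_norm_sq]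
    simp [Complex.normSq_apply]
  have h0 : ∀ i, 0 ≤ (Q i i).re := fun i => by rw [hsum]; positivity
  have h1 : ∀ i, (Q i i).re ≤ 1 := by
    intro i
    have h2 : (Q i i).re ^ 2 ≤ (Q i i).re := by
      calc (Q i i).re ^ 2 ≤ ‖Q i i‖ ^ 2 := by
            rw [← sq_abs (Q i i).re]
            gcongr
            exact Complex.abs_re_le_norm _
        _ ≤ ∑ j, ‖Q i j‖ ^ 2 :=
            Finset.single_le_sum (f := fun j => ‖Q i j‖ ^ 2) (fun j _ => by positivity)
              (Finset.mem_univ i)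
        _ = (Q i i).re := (hsum i).symm
    nlinarith [h0 i]
  have htr : (P * ρ).trace = (Q * diagonal (fun i => (l i : ℂ))).trace := by
    rw [← hd, hQ, show Uᴴ * P * U * (Uᴴ * ρ * U) = Uᴴ * (P * (U * Uᴴ) * ρ * U) by
      simp only [Matrix.mul_assoc], hU', Matrix.mul_one, trace_mul_comm Uᴴ, Matrix.mul_assoc _ U, hU',
      Matrix.mul_one]
  have htP : P.trace = Q.trace := by
    rw [hQ, Matrix.mul_assoc, trace_mul_comm, Matrix.mul_assoc, hU', Matrix.mul_one]
  rw [htr, htP, ht]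
  simp only [Matrix.trace, diag, mul_diagonal, Complex.re_sum, Complex.re_mul_ofReal]
  rw [Finset.mul_sum, ← Finset.sum_add_distrib]
  refine Finset.sum_le_sum fun i _ => ?_
  -- For q in [0, 1], q(l - c) ≤ q max(l - c, 0) ≤ max(l - c, 0).
  nlinarith [h0 i, h1 i, le_max_left (l i - c) 0, le_max_right (l i - c) 0,
    mul_le_mul_of_nonneg_left (le_max_left (l i - c) 0) (h0 i),
    mul_nonneg (sub_nonneg.2 (h1 i)) (le_max_right (l i - c) 0)]

/-! ### One-shot converse -/

lemma trace_conjTranspose_mul_self_re {m n : ℕ} (A : Matrix (Fin m) (Fin n) ℂ) :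
    (Aᴴ * A).trace.re = ∑ p : Fin m × Fin n, ‖A p.1 p.2‖ ^ 2 := by
  simp only [Matrix.trace, diag, Matrix.mul_apply, conjTranspose_apply, Complex.re_sum,
    Fintype.sum_prod_type]
  rw [Finset.sum_comm]
  refine Finset.sum_congr rfl fun i _ => Finset.sum_congr rfl fun j _ => ?_
  rw [← Complex.normSq_eq_norm_sq]
  simp [Complex.normSq_apply]

lemma norm_trace_conjTranspose_mul_sq_le {m n : ℕ} (A B : Matrix (Fin m) (Fin n) ℂ) :
    ‖(Aᴴ * B).trace‖ ^ 2 ≤ (Aᴴ * A).trace.re * (Bᴴ * B).trace.re := by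
  have h : (Aᴴ * B).trace = ∑ p : Fin m × Fin n, star (A p.1 p.2) * B p.1 p.2 := by
    simp only [Matrix.trace, diag, Matrix.mul_apply, conjTranspose_apply, Fintype.sum_prod_type]
    exact Finset.sum_comm
  rw [trace_conjTranspose_mul_self_re, trace_conjTranspose_mul_self_re, h]
  calc ‖∑ p : Fin m × Fin n, star (A p.1 p.2) * B p.1 p.2‖ ^ 2
      ≤ (∑ p : Fin m × Fin n, ‖A p.1 p.2‖ * ‖B p.1 p.2‖) ^ 2 := by
        gcongr
        refine (norm_sum_le _ _).trans_eq ?_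
        simp
    _ ≤ _ := Finset.sum_mul_sq_le_sq_mul_sq _ _ _

lemma isHermitian_partialTraceB_ketBra {a b : ℕ} (φ : BipartiteVec a b) :
    (partialTraceB (ketBra φ)).IsHermitian := by
  rw [partialTraceB_ketBra]
  exact isHermitian_mul_conjTranspose_self _

/-- The squared overlap with a vector of Schmidt rank at most `M`. -/
theorem norm_sq_inner_le_of_rank_le {a b M : ℕ} (φ w : BipartiteVec a b)
    (hw : (coeffMatrix w).rank ≤ M) {c : ℝ} (hc : 0 ≤ c) :
    ‖star φ ⬝ᵥ w‖ ^ 2 ≤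
      (posPartTrace (partialTraceB (ketBra φ)) c + c * M) * (star w ⬝ᵥ w).re := by
  obtain ⟨P, hP, hPP, hPW, hPt⟩ := exists_range_projection (coeffMatrix w)
  rw [dotProduct_eq_trace, dotProduct_eq_trace]
  -- Moving P from `w` to `φ` before Cauchy–Schwarz replaces the norm of `φ` by Tr Pρ.
  have h1 : (coeffMatrix φ)ᴴ * coeffMatrix w = (P * coeffMatrix φ)ᴴ * coeffMatrix w := by
    rw [conjTranspose_mul, hP, Matrix.mul_assoc, hPW]
  rw [h1]
  refine (norm_trace_conjTranspose_mul_sq_le _ _).trans ?_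
  have h2 : ((P * coeffMatrix φ)ᴴ * (P * coeffMatrix φ)).trace =
      (P * partialTraceB (ketBra φ)).trace := by
    rw [partialTraceB_ketBra, conjTranspose_mul, hP, Matrix.mul_assoc, ← Matrix.mul_assoc P P, hPP,
      trace_mul_comm, Matrix.mul_assoc]
  rw [h2]
  have h3 : 0 ≤ ((coeffMatrix w)ᴴ * coeffMatrix w).trace.re := by
    rw [trace_conjTranspose_mul_self_re]
    positivity
  refine mul_le_mul_of_nonneg_right ?_ h3
  refine (trace_projection_mul_le (isHermitian_partialTraceB_ketBra φ) hP hPP c).trans ?_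
  rw [hPt, Complex.natCast_re]
  gcongr

lemma norm_sq_maxEntangled {M : ℕ} (hM : 0 < M) :
    star (maxEntangled M) ⬝ᵥ maxEntangled M = 1 := by
  have hM' : (M : ℂ) ≠ 0 := by exact_mod_cast hM.ne'
  have h : ((Real.sqrt M : ℝ) : ℂ) * (Real.sqrt M : ℝ) = M := by
    rw [← Complex.ofReal_mul, Real.mul_self_sqrt (Nat.cast_nonneg M)]
    simp
  simp only [dotProduct, Pi.star_apply, maxEntangled, Fintype.sum_prod_type]
  simp [apply_ite, ← mul_inv, h, hM']

/-- Converse bound: the overlap of the output of an LOCC operation on a maximally entangled state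
of rank `M`. -/
theorem IsLOCC.overlap_maxEntangled_le {a b M : ℕ} (hM : 0 < M)
    {T : BipartiteOp M M → BipartiteOp a b} (hT : IsLOCC T) (φ : BipartiteVec a b) {c : ℝ}
    (hc : 0 ≤ c) :
    overlap φ (T (ketBra (maxEntangled M))) ≤
      posPartTrace (partialTraceB (ketBra φ)) c + c * M := by
  have h := hT.overlap_le φ M _ (fun w hw => norm_sq_inner_le_of_rank_le φ w hw hc)
    (maxEntangled M) ((rank_le_width _))
  rwa [norm_sq_maxEntangled hM, Complex.one_re, mul_one] at h

/-! ### One-shot achievability -/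

lemma overlap_eq_norm_trace_sq {a b : ℕ} (φ w : BipartiteVec a b) :
    overlap φ (ketBra w) = ‖((coeffMatrix φ)ᴴ * coeffMatrix w).trace‖ ^ 2 := by
  rw [overlap_ketBra, dotProduct_eq_trace]

lemma coeffMatrix_maxEntangled (M : ℕ) :
    coeffMatrix (maxEntangled M) = (((Real.sqrt M)⁻¹ : ℝ) : ℂ) • (1 : Matrix (Fin M) (Fin M) ℂ) := by
  ext i j
  simp [coeffMatrix, maxEntangled, one_apply]

/-- If the columns of `V` are orthonormal eigenvectors of the reduced state of `φ`, then the
projection of `φ` on their span can be prepared from the maximally entangled state: Bob measures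
with cyclic shifts of the coefficient matrix, and Alice corrects the shift. -/
theorem exists_isLOCC_overlap_eq {a b M : ℕ} [NeZero M] (φ : BipartiteVec a b)
    (V : Matrix (Fin a) (Fin M) ℂ) (hV : Vᴴ * V = 1) (l : Fin M → ℝ)
    (hl : Vᴴ * partialTraceB (ketBra φ) * V = diagonal (fun i => (l i : ℂ)))
    (hpos : 0 < ∑ i, l i) :
    ∃ T : BipartiteOp M M → BipartiteOp a b, IsLOCC T ∧
      overlap φ (T (ketBra (maxEntangled M))) = ∑ i, l i := by
  set p := ∑ i, l i with hp
  set N : Matrix (Fin b) (Fin M) ℂ := (Vᴴ * coeffMatrix φ)ᵀ with hN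
  have hNN : Nᴴ * N = diagonal (fun i => (l i : ℂ)) := by
    have h : (Nᴴ * N)ᵀ = diagonal (fun i => (l i : ℂ)) := by
      have h' : (Nᴴ)ᵀ = (Vᴴ * coeffMatrix φ)ᴴ := rfl
      rw [← hl, partialTraceB_ketBra, transpose_mul, h', hN]
      simp only [transpose_transpose, conjTranspose_mul, conjTranspose_conjTranspose,
        Matrix.mul_assoc]
    rw [← transpose_transpose (Nᴴ * N), h, diagonal_transpose]
  set s : ℂ := (((Real.sqrt p)⁻¹ : ℝ) : ℂ) with hs
  have hss : s * star s = (p : ℂ)⁻¹ := by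
    rw [hs, Complex.star_def, Complex.conj_ofReal, ← Complex.ofReal_mul, ← mul_inv,
      Real.mul_self_sqrt hpos.le, Complex.ofReal_inv]
  have hp0 : (p : ℂ) ≠ 0 := by exact_mod_cast hpos.ne'
  -- Each (K k)ᴴ * K k is a cyclically shifted diagonal of the `l i`, divided by p. Summing over all
  -- shifts puts p / p = 1 in every diagonal entry.
  let K : Fin M → Matrix (Fin b) (Fin M) ℂ := fun k => s • N.submatrix id (Equiv.addRight k)
  let A : Fin M → Matrix (Fin a) (Fin M) ℂ := fun k => V.submatrix id (Equiv.addRight k)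
  have hK : ∑ k, (K k)ᴴ * K k = 1 := by
    have h1 : ∀ k, (K k)ᴴ * K k = (p : ℂ)⁻¹ •
        (diagonal (fun i => (l i : ℂ))).submatrix (Equiv.addRight k) (Equiv.addRight k) := by
      intro k
      rw [← hNN]
      simp only [K, conjTranspose_smul, Matrix.smul_mul, Matrix.mul_smul, smul_smul, hss]
      rfl
    simp only [h1]
    rw [← Finset.smul_sum]
    ext i j
    rw [Matrix.smul_apply, Matrix.sum_apply]
    by_cases hij : i = j
    · subst hij
      simp only [submatrix_apply, diagonal_apply_eq, one_apply_eq, smul_eq_mul]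
      have : ∑ k, (l (Equiv.addRight k i) : ℂ) = p := by
        rw [hp, Complex.ofReal_sum]
        exact Equiv.sum_comp (Equiv.addLeft i) (fun k => (l k : ℂ))
      rw [this, inv_mul_cancel₀ hp0]
    · simp [hij]
  have hA : ∀ k, ∑ _i : Fin 1, (A k)ᴴ * A k = 1 := by
    intro k
    have : (A k)ᴴ * A k = (Vᴴ * V).submatrix (Equiv.addRight k) (Equiv.addRight k) := rfl
    rw [Fin.sum_univ_one, this, hV, submatrix_one_equiv]
  refine ⟨_, IsLOCC.bob (fun _ => b) K hK _
    (fun k => IsLOCC.alice (fun _ : Fin 1 => a) (fun _ => A k) (hA k) _ fun _ => IsLOCC.done), ?_⟩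
  have hM : (0 : ℝ) < M := by exact_mod_cast Nat.pos_of_ne_zero (NeZero.ne M)
  -- Alice's shift cancels Bob's, so every outcome yields the projected `φ` scaled by (pM)^(-1/2),
  -- with overlap p² / (pM).
  have hterm : ∀ k : Fin M, overlap φ (ketBra ((A k ⊗ₖ (1 : Matrix (Fin b) (Fin b) ℂ)) *ᵥ
      (((1 : Matrix (Fin M) (Fin M) ℂ) ⊗ₖ K k) *ᵥ maxEntangled M))) = p / M := by
    intro k
    have h1 : A k * (K k)ᵀ = s • (V * (Vᴴ * coeffMatrix φ)) := by
      have : A k * (K k)ᵀ = s • (V.submatrix id (Equiv.addRight k) *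
          (Nᵀ).submatrix (Equiv.addRight k) id) := by
        simp only [A, K, transpose_smul, Matrix.mul_smul]
        rfl
      rw [this, submatrix_mul_equiv, hN, transpose_transpose]
      rfl
    have h2 : ((coeffMatrix φ)ᴴ * (V * (Vᴴ * coeffMatrix φ))).trace = p := by
      rw [← Matrix.mul_assoc, trace_mul_comm, Matrix.mul_assoc, ← Matrix.mul_assoc (coeffMatrix φ),
        ← Matrix.mul_assoc, ← partialTraceB_ketBra, hl, trace_diagonal, hp, Complex.ofReal_sum]
    rw [overlap_eq_norm_trace_sq, coeffMatrix_kronecker_one_mulVec,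
      coeffMatrix_one_kronecker_mulVec, coeffMatrix_maxEntangled, Matrix.smul_mul, Matrix.one_mul,
      Matrix.mul_smul, h1, Matrix.mul_smul, Matrix.mul_smul, trace_smul, trace_smul, h2, hs,
      smul_eq_mul, smul_eq_mul, norm_mul, norm_mul, Complex.norm_real, Complex.norm_real,
      Complex.norm_real, mul_pow, mul_pow]
    simp only [Real.norm_eq_abs, sq_abs, inv_pow, Real.sq_sqrt hpos.le, Real.sq_sqrt hM.le]
    field_simp
  simp only [overlap_sum, mul_ketBra_mul, hterm]
  simp
  field_simp

/-- An orthonormal eigenbasis of the reduced state, with the squared Schmidt coefficients. -/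
theorem exists_schmidt_posPartTrace {a b : ℕ} (φ : BipartiteVec a b) (hφ : star φ ⬝ᵥ φ = 1)
    (c : ℝ) :
    ∃ (U : Matrix (Fin a) (Fin a) ℂ) (l : Fin a → ℝ), Uᴴ * U = 1 ∧
      Uᴴ * partialTraceB (ketBra φ) * U = diagonal (fun i => (l i : ℂ)) ∧
      posPartTrace (partialTraceB (ketBra φ)) c = ∑ i, max (l i - c) 0 ∧
      (∀ i, 0 ≤ l i) ∧ ∑ i, l i = 1 := by
  obtain ⟨U, l, hU, hU', hd, ht⟩ :=
    exists_diagonalization_posPartTrace (isHermitian_partialTraceB_ketBra φ) c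
  have hl0 : ∀ i, 0 ≤ l i := by
    intro i
    have h : ((((coeffMatrix φ)ᴴ * U)ᴴ * ((coeffMatrix φ)ᴴ * U)) i i).re = l i := by
      have : ((coeffMatrix φ)ᴴ * U)ᴴ * ((coeffMatrix φ)ᴴ * U) =
          diagonal (fun i => (l i : ℂ)) := by
        rw [← hd, partialTraceB_ketBra]
        simp only [conjTranspose_mul, conjTranspose_conjTranspose, Matrix.mul_assoc]
      rw [this, diagonal_apply_eq, Complex.ofReal_re]
    rw [← h, Matrix.mul_apply, Complex.re_sum]
    refine Finset.sum_nonneg fun j _ => ?_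
    rw [conjTranspose_apply]
    generalize ((coeffMatrix φ)ᴴ * U) j i = z
    simpa using add_nonneg (mul_self_nonneg z.re) (mul_self_nonneg z.im)
  have hl1 : ∑ i, l i = 1 := by
    have h : (diagonal (fun i => (l i : ℂ))).trace = 1 := by
      rw [← hd, trace_mul_comm, ← Matrix.mul_assoc, hU', Matrix.one_mul, partialTraceB_ketBra,
        trace_mul_comm, ← dotProduct_eq_trace, hφ]
    rw [trace_diagonal] at h
    exact_mod_cast h
  exact ⟨U, l, hU, hd, ht, hl0, hl1⟩

lemma posPartTrace_le_one {a b : ℕ} (φ : BipartiteVec a b) (hφ : star φ ⬝ᵥ φ = 1) {c : ℝ}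
    (hc : 0 ≤ c) : posPartTrace (partialTraceB (ketBra φ)) c ≤ 1 := by
  obtain ⟨U, l, -, -, ht, hl0, hl1⟩ := exists_schmidt_posPartTrace φ hφ c
  rw [ht, ← hl1]
  exact Finset.sum_le_sum fun i _ => max_le (by linarith) (hl0 i)

lemma posPartTrace_eq_zero {a b : ℕ} (φ : BipartiteVec a b) (hφ : star φ ⬝ᵥ φ = 1) {c : ℝ}
    (hc : 1 ≤ c) : posPartTrace (partialTraceB (ketBra φ)) c = 0 := by
  obtain ⟨U, l, -, -, ht, hl0, hl1⟩ := exists_schmidt_posPartTrace φ hφ c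
  rw [ht]
  refine Finset.sum_eq_zero fun i hi => max_eq_right ?_
  have := Finset.single_le_sum (f := l) (fun j _ => hl0 j) hi
  linarith

/-- Achievability: there is a maximally entangled state of rank at most `max 1 c⁻¹` that LOCC
transforms to a state whose overlap with `φ` is at least the trace of the positive part of
`ρ - c I`. -/
theorem exists_isLOCC_posPartTrace_le {a b : ℕ} (φ : BipartiteVec a b) (hφ : star φ ⬝ᵥ φ = 1)
    {c : ℝ} (hc : 0 < c) (hc1 : c ≤ 1) :
    ∃ (M : ℕ) (T : BipartiteOp M M → BipartiteOp a b), 0 < M ∧ (M : ℝ) ≤ c⁻¹ ∧ IsLOCC T ∧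
      posPartTrace (partialTraceB (ketBra φ)) c ≤ overlap φ (T (ketBra (maxEntangled M))) := by
  obtain ⟨U, l, hU, hd, ht, hl0, hl1⟩ := exists_schmidt_posPartTrace φ hφ c
  obtain ⟨S, hSpos, hScard, hSt⟩ : ∃ S : Finset (Fin a), 0 < ∑ i ∈ S, l i ∧
      (S.card : ℝ) ≤ c⁻¹ ∧ posPartTrace (partialTraceB (ketBra φ)) c ≤ ∑ i ∈ S, l i := by
    -- The eigenvalues at least c number at most 1/c because they sum to at most 1. If there are
    -- none, t(c) = 0 and any positive eigenvalue serves; the rank 1 is allowed since c ≤ 1.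
    by_cases hS : ∃ i, c ≤ l i
    · obtain ⟨i, hi⟩ := hS
      have hle : ∑ j with c ≤ l j, l j ≤ 1 := by
        rw [← hl1]
        exact Finset.sum_le_sum_of_subset_of_nonneg (Finset.subset_univ _) fun i _ _ => hl0 i
      refine ⟨Finset.univ.filter fun j => c ≤ l j, ?_, ?_, ?_⟩
      · exact (hc.trans_le hi).trans_le
          (Finset.single_le_sum (f := l) (fun j _ => hl0 j) (by simpa using hi))
      · rw [← one_div, le_div_iff₀ hc]
        refine le_trans ?_ hle
        rw [← nsmul_eq_mul]
        exact Finset.card_nsmul_le_sum _ _ _ fun j hj => (Finset.mem_filter.1 hj).2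
      · rw [ht, Finset.sum_filter]
        refine Finset.sum_le_sum fun j _ => ?_
        split_ifs with h
        · exact max_le (by linarith) (hl0 j)
        · exact max_le (by linarith) le_rfl
    · push Not at hS
      obtain ⟨i, -, hi⟩ : ∃ i ∈ Finset.univ, 0 < l i :=
        Finset.exists_lt_of_sum_lt (f := fun _ => (0 : ℝ)) (by simp [hl1])
      refine ⟨{i}, by simpa using hi, ?_, ?_⟩
      · simpa using (one_le_inv₀ hc).2 hc1
      · rw [ht, Finset.sum_singleton]
        refine (Finset.sum_nonpos fun j _ => ?_).trans hi.le
        exact max_le (by linarith [hS j]) le_rfl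
  have hScard0 : 0 < S.card := by
    refine Finset.card_pos.2 (Finset.nonempty_of_ne_empty ?_)
    rintro rfl
    simp at hSpos
  have : NeZero S.card := ⟨hScard0.ne'⟩
  let f : Fin S.card → Fin a := fun i => S.equivFin.symm i
  have hf : Function.Injective f := fun i j h => S.equivFin.symm.injective (Subtype.ext h)
  have hsum : ∑ i, l (f i) = ∑ i ∈ S, l i := by
    rw [← Finset.sum_coe_sort S]
    exact S.equivFin.symm.sum_comp (fun i : S => l i)
  obtain ⟨T, hT, hov⟩ := exists_isLOCC_overlap_eq φ (U.submatrix id f)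
    (by
      have : (U.submatrix id f)ᴴ * U.submatrix id f = (Uᴴ * U).submatrix f f := rfl
      rw [this, hU, submatrix_one f hf])
    (fun i => l (f i))
    (by
      have : (U.submatrix id f)ᴴ * partialTraceB (ketBra φ) * U.submatrix id f =
        (Uᴴ * partialTraceB (ketBra φ) * U).submatrix f f := rfl
      rw [this, hd, submatrix_diagonal _ f hf]
      rfl)
    (by rwa [hsum])
  exact ⟨S.card, T, hScard0, hScard, hT, hov ▸ hsum ▸ hSt⟩

/-! ### Asymptotic rates -/

/-- Dilution rates in terms of the traces of the positive parts of `ρ - e^{nγ} I`. -/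
theorem strongConverseDilutionRate_eq_partialTraceB (dA dB : ℕ → ℕ)
    (φ : ∀ n, BipartiteVec (dA n) (dB n)) (hφ : ∀ n, star (φ n) ⬝ᵥ φ n = 1) :
    strongConverseDilutionRate φ =
      infSpectralEntropyRate (fun n => partialTraceB (ketBra (φ n))) := by
  set t : ℝ → ℕ → ℝ := fun γ n =>
    posPartTrace (partialTraceB (ketBra (φ n))) (Real.exp (n * γ)) with ht
  have ht0 : ∀ γ n, 0 ≤ t γ n := fun γ n =>
    posPartTrace_nonneg (isHermitian_partialTraceB_ketBra (φ n)) _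
  have ht1 : ∀ γ n, t γ n ≤ 1 :=
    fun γ n => posPartTrace_le_one (φ n) (hφ n) (Real.exp_pos _).le
  have hlim : ∀ γ, limsup (t γ) atTop = 0 ↔ Tendsto (t γ) atTop (𝓝 0) := by
    intro γ
    have hb : IsBoundedUnder (· ≤ ·) atTop (t γ) := isBoundedUnder_of ⟨1, ht1 γ⟩
    have hb' : IsBoundedUnder (· ≥ ·) atTop (t γ) := isBoundedUnder_of ⟨0, ht0 γ⟩
    refine ⟨fun h => tendsto_of_le_liminf_of_limsup_le ?_ h.le hb hb', fun h => h.limsup_eq⟩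
    exact le_liminf_of_le hb.isCoboundedUnder_ge (Eventually.of_forall (ht0 γ))
  have hD : infSpectralEntropyRate (fun n => partialTraceB (ketBra (φ n))) =
      -sInf (Real.toEReal '' {γ : ℝ | limsup (t γ) atTop = 0}) := rfl
  simp only [hD, hlim]
  refine le_antisymm (sSup_le ?_) (EReal.neg_le_of_neg_le (le_sInf ?_))
  · rintro _ ⟨R, hR, rfl⟩
    refine EReal.le_neg_of_le_neg (sInf_le ⟨-R, ?_, EReal.coe_neg R⟩)
    -- For R < 0 the threshold exp(-nR) is at least 1, where the positive part vanishes; otherwise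
    -- it is at most 1 and achievability applies.
    rcases lt_or_ge R 0 with hR0 | hR0
    · have : t (-R) = fun _ => 0 := by
        funext n
        refine posPartTrace_eq_zero (φ n) (hφ n) (Real.one_le_exp ?_)
        exact mul_nonneg n.cast_nonneg (by linarith)
      simp [this]
    · have hex : ∀ n : ℕ, Real.exp (n * -R) ≤ 1 := fun n =>
        Real.exp_le_one_iff.2 (mul_nonpos_of_nonneg_of_nonpos n.cast_nonneg (by linarith))
      choose M T hM hMc hT hov using fun n =>
        exists_isLOCC_posPartTrace_le (φ n) (hφ n) (Real.exp_pos (n * -R)) (hex n)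
      refine squeeze_zero (ht0 (-R)) hov (hR ⟨M, hM, T, hT⟩ ?_)
      filter_upwards [eventually_gt_atTop 0] with n hn
      have hn' : (0 : ℝ) < n := Nat.cast_pos.2 hn
      have h := hMc n
      rw [← Real.exp_neg, ← Real.log_le_iff_le_exp (Nat.cast_pos.2 (hM n))] at h
      rw [one_div, inv_mul_le_iff₀ hn']
      simpa using h
  · rintro _ ⟨γ, hγ, rfl⟩
    refine EReal.neg_le_of_neg_le ?_
    rw [← EReal.coe_neg]
    -- Strictness R < -γ makes the error term c M ≤ exp(n(R + γ)) of the converse vanish.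
    refine EReal.ge_of_forall_gt_iff_ge.1 fun R hR => le_sSup ⟨R, fun P hP => ?_, rfl⟩
    have hR' : R + γ < 0 := by
      have := EReal.coe_lt_coe_iff.1 hR
      linarith
    have hexp : Tendsto (fun n : ℕ => Real.exp (n * (R + γ))) atTop (𝓝 0) :=
      Real.tendsto_exp_atBot.comp (tendsto_natCast_atTop_atTop.atTop_mul_const_of_neg hR')
    have hsum : Tendsto (fun n => t γ n + Real.exp (n * (R + γ))) atTop (𝓝 0) := by
      simpa using Tendsto.add hγ hexp
    refine squeeze_zero' (Eventually.of_forall fun n => (P.isLOCC n).overlap_nonneg _ _) ?_ hsum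
    filter_upwards [hP, eventually_gt_atTop 0] with n hn hn0
    refine ((P.isLOCC n).overlap_maxEntangled_le (P.M_pos n) (φ n)
      (Real.exp_pos (n * γ)).le).trans ?_
    have hn' : (0 : ℝ) < n := Nat.cast_pos.2 hn0
    rw [one_div, inv_mul_le_iff₀ hn', Real.log_le_iff_le_exp (Nat.cast_pos.2 (P.M_pos n))] at hn
    rw [mul_add, add_comm (n * R : ℝ), Real.exp_add]
    gcongr

/-! ### The other subsystem -/

/-- Exchange of the two subsystems. -/
def swapVec {a b : ℕ} (v : BipartiteVec a b) : BipartiteVec b a := fun p => v p.swap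

lemma overlap_swapOp {a b : ℕ} (φ : BipartiteVec a b) (X : BipartiteOp a b) :
    overlap (swapVec φ) (swapOp X) = overlap φ X := by
  have h : swapOp X *ᵥ swapVec φ = swapVec (X *ᵥ φ) := by
    funext p
    exact Equiv.sum_comp (Equiv.prodComm _ _) (fun q => X p.swap q * φ q)
  rw [overlap, h]
  exact congrArg Complex.re
    (Equiv.sum_comp (Equiv.prodComm _ _) (fun q => star φ q * (X *ᵥ φ) q))

lemma swapOp_ketBra_maxEntangled (M : ℕ) :
    swapOp (ketBra (maxEntangled M)) = ketBra (maxEntangled M) := by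
  have h : ∀ p, maxEntangled M p.swap = maxEntangled M p := fun p => by
    simp [maxEntangled, eq_comm]
  ext p q
  simp [swapOp, ketBra, vecMulVec_apply, h]

/-- Conjugating a protocol by the swap keeps its ranks and fidelities, as the maximally entangled
state is symmetric. Applying this twice gives equality. -/
theorem strongConverseDilutionRate_le_swap {dA dB : ℕ → ℕ}
    (φ : ∀ n, BipartiteVec (dA n) (dB n)) :
    strongConverseDilutionRate φ ≤ strongConverseDilutionRate (fun n => swapVec (φ n)) := by
  refine sSup_le_sSup (Set.image_mono fun R hR P hP => ?_)
  refine (hR ⟨P.M, P.M_pos, fun n X => swapOp (P.T n (swapOp X)),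
    fun n => (P.isLOCC n).swap⟩ hP).congr fun n => ?_
  change overlap (φ n) (swapOp (P.T n (swapOp (ketBra (maxEntangled (P.M n)))))) =
    overlap (swapVec (φ n)) (P.T n (ketBra (maxEntangled (P.M n))))
  rw [swapOp_ketBra_maxEntangled, ← overlap_swapOp]
  rfl

theorem strongConverseDilutionRate_swap {dA dB : ℕ → ℕ} (φ : ∀ n, BipartiteVec (dA n) (dB n)) :
    strongConverseDilutionRate (fun n => swapVec (φ n)) = strongConverseDilutionRate φ :=
  le_antisymm (strongConverseDilutionRate_le_swap fun n => swapVec (φ n))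
    (strongConverseDilutionRate_le_swap φ)

lemma norm_sq_swapVec {a b : ℕ} (v : BipartiteVec a b) :
    star (swapVec v) ⬝ᵥ swapVec v = star v ⬝ᵥ v :=
  Equiv.sum_comp (Equiv.prodComm _ _) (fun q => star v q * v q)

end

end EntanglementDilution

theorem mainTheorem6 (dA dB : ℕ → ℕ)
    (φ : ∀ n, EntanglementDilution.BipartiteVec (dA n) (dB n))
    (hφ : ∀ n, star (φ n) ⬝ᵥ φ n = 1) :
    EntanglementDilution.strongConverseDilutionRate φ =
        EntanglementDilution.infSpectralEntropyRate
          (fun n => EntanglementDilution.partialTraceA (EntanglementDilution.ketBra (φ n))) ∧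
      EntanglementDilution.strongConverseDilutionRate φ =
        EntanglementDilution.infSpectralEntropyRate
          (fun n => EntanglementDilution.partialTraceB (EntanglementDilution.ketBra (φ n))) := by
  refine ⟨?_, EntanglementDilution.strongConverseDilutionRate_eq_partialTraceB dA dB φ hφ⟩
  rw [← EntanglementDilution.strongConverseDilutionRate_swap φ]
  exact EntanglementDilution.strongConverseDilutionRate_eq_partialTraceB dB dA _
    fun n => (EntanglementDilution.norm_sq_swapVec (φ n)).trans (hφ n)
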